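/- Let $N,d\in\mathbb N$ and, for $j,k=1,\dots,N$, let $a_{jk}:[0,+\infty)\to[0,+\infty)$ be Lebesgue measurable and bounded. Then, for every pair $j,k$, the following properties are equivalent: (A) $\displaystyle\limsup_{T\to+\infty}\,\liminf_{t\to+\infty}\int_t^{t+T}a_{jk}(s)\,ds>0$ (possibly $+\infty$); (B) there exist $T,\mu>0$ such that $\int_t^{t+T}a_{jk}(s)\,ds\ge\mu$ for all $t\ge 0$; (C) there exist $T,\mu>0$ and a sequence $t_n\to+\infty$ in $[0,+\infty)$, with $\{t_{n+1}-t_n\}_{n\in\mathbb N}$ bounded, such that $\int_{t_n}^{t_n+T}a_{jk}(s)\,ds\ge\mu$ for all $n\in\mathbb N$. Let $G$ be the directed graph with nodes $\{1,\dots,N\}$ and an arrow from $j$ to $k$ if one of the (equivalent) properties (A), (B), (C) holds for $a_{jk}$. Assume that $G$ has a globally reachable node, that is, a node $\ell^*$ such that from every node $i$ there is a directed path to $\ell^*$ (the path of length $0$ being allowed for $i=\ell^*$). Then, for all initial configurations $(x_1(0),\dots,x_N(0))\in(\mathbb R^d)^N$, the solutions of $$\dot x_j=\sum_{k=1}^N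 a_{jk}(t)\,(x_k-x_j),\qquad j=1,\dots,N,$$ converge to consensus: there is $x^*\in\mathbb R^d$ with $\lim_{t\to+\infty}x_j(t)=x^*$ for all $j$. Here solutions are meant in the Carathéodory sense: $x_1,\dots,x_N:[0,+\infty)\to\mathbb R^d$ are absolutely continuous on compact intervals and satisfy the equations at almost every time. -/

import Mathlib

open MeasureTheory Filter Topology

/-- `x` is a Caratheodory solution on `[0, ∞)` of the system
`x_j' = ∑ k, a j k t • (x_k - x_j)` of `N` agents in `ℝ^d`: every `x_j` is absolutely continuous
on each compact interval `[0, T]`, and the equations hold at almost every time `t > 0`.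
The values of `a` and `x` at negative times play no role. -/
def IsSolution {N d : ℕ} (a : Fin N → Fin N → ℝ → ℝ)
    (x : Fin N → ℝ → EuclideanSpace ℝ (Fin d)) : Prop :=
  (∀ j, ∀ T : ℝ, 0 < T → AbsolutelyContinuousOnInterval (x j) 0 T) ∧
  ∀ᵐ t ∂(volume.restrict (Set.Ioi (0 : ℝ))),
    ∀ j, HasDerivAt (x j) (∑ k, a j k t • (x k t - x j t)) t

/-- All agents tend to one common point as `t → +∞`. -/
def ConvergesToConsensus {N d : ℕ} (x : Fin N → ℝ → EuclideanSpace ℝ (Fin d)) : Prop :=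
  ∃ p : EuclideanSpace ℝ (Fin d), ∀ j, Tendsto (x j) atTop (𝓝 p)

/-- `limsup_{T → +∞} liminf_{t → +∞} ∫_t^{t+T} f > 0`. The limits are taken in the extended
reals, since the outer one may be `+∞`. -/
def ConditionA (f : ℝ → ℝ) : Prop :=
  0 < limsup (fun T : ℝ =>
    liminf (fun t : ℝ => ((∫ s in t..(t + T), f s : ℝ) : EReal)) atTop) atTop

/-- The integrals of `f` over all intervals of some fixed length have a uniform positive lower
bound. -/
def ConditionB (f : ℝ → ℝ) : Prop :=
  ∃ T μ : ℝ, 0 < T ∧ 0 < μ ∧ ∀ t : ℝ, 0 ≤ t → μ ≤ ∫ s in t..(t + T), f s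

/-- The same lower bound, only on intervals that start at the terms of some sequence of
nonnegative times that tends to infinity with bounded gaps. -/
def ConditionC (f : ℝ → ℝ) : Prop :=
  ∃ T μ : ℝ, 0 < T ∧ 0 < μ ∧ ∃ t : ℕ → ℝ, (∀ n, 0 ≤ t n) ∧ Tendsto t atTop atTop ∧
    (∃ K : ℝ, ∀ n, |t (n + 1) - t n| ≤ K) ∧
    ∀ n, μ ≤ ∫ s in (t n)..(t n + T), f s

/-- The directed graph on the agents with an arrow from `j` to `k` if one of the three conditions
holds for `a j k`. -/
def connectionGraph {N : ℕ} (a : Fin N → Fin N → ℝ → ℝ) : Digraph (Fin N) where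
  Adj j k := ConditionA (a j k) ∨ ConditionB (a j k) ∨ ConditionC (a j k)

/-- From every node there is a directed path (of length `0` for `l` itself) to the node `l`. -/
def IsGloballyReachable {V : Type*} (G : Digraph V) (l : V) : Prop :=
  ∀ i, Relation.ReflTransGen G.Adj i l

/-!
Conditions (A), (B) and (C) are compared by monotonicity of the integral of a nonnegative function
in its interval: a lower bound on short intervals that occur with bounded gaps, or only from some
time on, is a lower bound on all intervals of a longer fixed length.

Consensus is proved for one coordinate at a time, since the system acts on coordinates separately.
With `C` a common bound of the `a j k` and `A = card ι * C`, the weighted state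
`z j t = exp (A t) * y j t` has derivative `(A - ∑ k, a j k) * z j + ∑ k, a j k * z k`, in which all
coefficients are nonnegative. Hence the nonnegative orthant is forward invariant (a Grönwall
argument for the total negative part, `IsScalarSolution.nonneg_of_nonneg`), every `z j` is
nondecreasing along nonnegative solutions (`IsScalarSolution.weighted_le_weighted`), and an arrow
from `j` to `k` makes `z j` at the end of a window at least `μ` times `z k` at its start
(`IsScalarSolution.mul_integral_le_weighted`). Following paths to the root `l` gives `S > 0` and
`c > 0` with `c * y l t₀ ≤ y i (t₀ + S)` for all `i`, uniformly in `t₀` and in the nonnegative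
solution (`exists_uniform_le_of_globally_reachable`).

If all agents lie in `[m, M]` at time `t₀`, this applies to `y - m` or to `M - y`, according to the
half of `[m, M]` that contains the root. Within time `S` the agents therefore enter an interval
shorter by the factor `1 - c / 2`, which they never leave, and the states are Cauchy with a common
limit.
-/

/-! ### The three conditions -/

theorem ConditionB.conditionC {f : ℝ → ℝ} (h : ConditionB f) : ConditionC f := by
  obtain ⟨T, μ, hT, hμ, h⟩ := h
  exact ⟨T, μ, hT, hμ, fun n => n, fun n => n.cast_nonneg, tendsto_natCast_atTop_atTop,
    ⟨1, fun n => by simp⟩, fun n => h n n.cast_nonneg⟩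

theorem integral_le_integral_of_subinterval {f : ℝ → ℝ} (hf0 : ∀ t, 0 ≤ t → 0 ≤ f t)
    (hfi : ∀ s t : ℝ, 0 ≤ s → s ≤ t → IntervalIntegrable f volume s t)
    {a b c d : ℝ} (ha : 0 ≤ a) (hac : a ≤ c) (hcd : c ≤ d) (hdb : d ≤ b) :
    ∫ s in c..d, f s ≤ ∫ s in a..b, f s := by
  refine intervalIntegral.integral_mono_interval hac hcd hdb ?_
    (hfi a b ha (hac.trans (hcd.trans hdb)))
  filter_upwards [ae_restrict_mem measurableSet_Ioc] with x hx
  exact hf0 x (ha.trans hx.1.le)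

theorem ConditionC.conditionB {f : ℝ → ℝ} (hf0 : ∀ t, 0 ≤ t → 0 ≤ f t)
    (hfi : ∀ s t : ℝ, 0 ≤ s → s ≤ t → IntervalIntegrable f volume s t)
    (h : ConditionC f) : ConditionB f := by
  obtain ⟨T, μ, hT, hμ, τ, hτ0, hτ, ⟨K, hK⟩, h⟩ := h
  have hK0 : 0 ≤ K := (abs_nonneg _).trans (hK 0)
  refine ⟨τ 0 + K + T, μ, by linarith [hτ0 0], hμ, fun t ht => ?_⟩
  have hex : ∃ n, t ≤ τ n := (hτ.eventually_ge_atTop t).exists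
  classical
  -- the first term of the sequence after `t` follows `t` within time `τ 0 + K`
  have hle : τ (Nat.find hex) ≤ t + τ 0 + K := by
    rcases Nat.eq_zero_or_pos (Nat.find hex) with h0 | hpos
    · rw [h0]; linarith
    · have h1 := Nat.find_min hex (Nat.sub_lt hpos one_pos)
      have h2 := (abs_le.1 (hK (Nat.find hex - 1))).2
      rw [Nat.sub_add_cancel hpos] at h2
      linarith [hτ0 0, not_le.1 h1]
  exact (h _).trans (integral_le_integral_of_subinterval hf0 hfi ht (Nat.find_spec hex)
    (by linarith) (by linarith))

theorem ConditionB.conditionA {f : ℝ → ℝ} (hf0 : ∀ t, 0 ≤ t → 0 ≤ f t)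
    (hfi : ∀ s t : ℝ, 0 ≤ s → s ≤ t → IntervalIntegrable f volume s t)
    (h : ConditionB f) : ConditionA f := by
  obtain ⟨T, μ, hT, hμ, h⟩ := h
  refine lt_of_lt_of_le (b := (μ : EReal)) (by exact_mod_cast hμ) ?_
  refine le_limsup_of_frequently_le (Eventually.frequently ?_)
  filter_upwards [eventually_ge_atTop T] with T' hT'
  refine le_liminf_of_le (by isBoundedDefault) ?_
  filter_upwards [eventually_ge_atTop 0] with t ht
  exact EReal.coe_le_coe_iff.2 ((h t ht).trans
    (integral_le_integral_of_subinterval hf0 hfi ht le_rfl (by linarith) (by linarith)))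

theorem ConditionA.conditionB {f : ℝ → ℝ} (hf0 : ∀ t, 0 ≤ t → 0 ≤ f t)
    (hfi : ∀ s t : ℝ, 0 ≤ s → s ≤ t → IntervalIntegrable f volume s t)
    (h : ConditionA f) : ConditionB f := by
  obtain ⟨T, hT, hT0⟩ := ((frequently_lt_of_lt_limsup (by isBoundedDefault) h).and_eventually
    (eventually_gt_atTop 0)).exists
  obtain ⟨μ, hμ0, hμ⟩ := EReal.lt_iff_exists_real_btwn.1 hT
  obtain ⟨t₀, ht₀⟩ := eventually_atTop.1 (eventually_lt_of_lt_liminf hμ (by isBoundedDefault))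
  refine ⟨max t₀ 0 + T, μ, by positivity, by exact_mod_cast hμ0, fun t ht => ?_⟩
  have h1 := EReal.coe_lt_coe_iff.1 (ht₀ (t + max t₀ 0) (by linarith [le_max_left t₀ 0]))
  exact h1.le.trans (integral_le_integral_of_subinterval hf0 hfi ht
    (by linarith [le_max_right t₀ 0]) (by linarith) (by linarith))

theorem intervalIntegrable_of_bounded_on_nonneg {f : ℝ → ℝ} (hf0 : ∀ t, 0 ≤ t → 0 ≤ f t)
    (hfm : AEMeasurable f (volume.restrict (Set.Ici (0 : ℝ))))
    (hfb : ∃ M : ℝ, ∀ t : ℝ, 0 ≤ t → f t ≤ M) {s t : ℝ} (hs : 0 ≤ s) (hst : s ≤ t) :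
    IntervalIntegrable f volume s t := by
  obtain ⟨M, hM⟩ := hfb
  have hsub : Set.Ioc s t ⊆ Set.Ici (0 : ℝ) := fun x hx => hs.trans hx.1.le
  rw [intervalIntegrable_iff_integrableOn_Ioc_of_le hst]
  refine Integrable.of_bound
    (hfm.mono_measure (Measure.restrict_mono_set _ hsub)).aestronglyMeasurable M ?_
  filter_upwards [ae_restrict_mem measurableSet_Ioc] with x hx
  rw [Real.norm_of_nonneg (hf0 x (hsub hx))]
  exact hM x (hsub hx)

theorem conditions_tfae {f : ℝ → ℝ} (hf0 : ∀ t, 0 ≤ t → 0 ≤ f t)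
    (hfi : ∀ s t : ℝ, 0 ≤ s → s ≤ t → IntervalIntegrable f volume s t) :
    List.TFAE [ConditionA f, ConditionB f, ConditionC f] := by
  tfae_have 1 → 2 := ConditionA.conditionB hf0 hfi
  tfae_have 2 → 1 := ConditionB.conditionA hf0 hfi
  tfae_have 2 → 3 := ConditionB.conditionC
  tfae_have 3 → 2 := ConditionC.conditionB hf0 hfi
  tfae_finish

/-! ### Scalar solutions -/

/-- The analogue of `IsSolution` for real-valued states and an arbitrary finite set of agents. -/
structure IsScalarSolution {ι : Type*} [Fintype ι] (a : ι → ι → ℝ → ℝ) (y : ι → ℝ → ℝ) :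
    Prop where
  absolutelyContinuous : ∀ j, ∀ T : ℝ, 0 < T → AbsolutelyContinuousOnInterval (y j) 0 T
  ae_hasDerivAt : ∀ᵐ t ∂(volume.restrict (Set.Ioi (0 : ℝ))),
    ∀ j, HasDerivAt (y j) (∑ k, a j k t * (y k t - y j t)) t

theorem IsSolution.coordinate {N d : ℕ} {a : Fin N → Fin N → ℝ → ℝ}
    {x : Fin N → ℝ → EuclideanSpace ℝ (Fin d)} (hx : IsSolution a x) (i : Fin d) :
    IsScalarSolution a (fun j t => x j t i) where
  absolutelyContinuous j T hT := by
    have h := hx.1 j T hT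
    rw [absolutelyContinuousOnInterval_iff] at h ⊢
    intro ε hε
    obtain ⟨δ, hδ, h⟩ := h ε hε
    refine ⟨δ, hδ, fun E hE hlt => lt_of_le_of_lt (Finset.sum_le_sum fun n _ => ?_) (h E hE hlt)⟩
    rw [dist_eq_norm, dist_eq_norm, ← PiLp.sub_apply]
    exact PiLp.norm_apply_le _ i
  ae_hasDerivAt := by
    filter_upwards [hx.2] with t ht j
    refine ((EuclideanSpace.proj (𝕜 := ℝ) i).hasFDerivAt.comp_hasDerivAt t (ht j)).congr_deriv ?_
    simp

namespace IsScalarSolution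

variable {ι : Type*} [Fintype ι] {a : ι → ι → ℝ → ℝ} {y : ι → ℝ → ℝ}

theorem affine (hy : IsScalarSolution a y) (c b : ℝ) :
    IsScalarSolution a (fun j t => c * y j t + b) where
  absolutelyContinuous j T hT :=
    ((hy.absolutelyContinuous j T hT).const_mul c).fun_add
      (LipschitzWith.const b).lipschitzOnWith.absolutelyContinuousOnInterval
  ae_hasDerivAt := by
    filter_upwards [hy.ae_hasDerivAt] with t ht j
    refine (((ht j).const_mul c).add_const b).congr_deriv ?_
    rw [Finset.mul_sum]
    exact Finset.sum_congr rfl fun k _ => by ring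

theorem continuousOn (hy : IsScalarSolution a y) (j : ι) : ContinuousOn (y j) (Set.Ici 0) := by
  intro t ht
  have ht : (0 : ℝ) ≤ t := ht
  have h := (hy.absolutelyContinuous j (t + 1) (by linarith)).continuousOn
  rw [Set.uIcc_of_le (by linarith)] at h
  refine (h t ⟨ht, by linarith⟩).mono_of_mem_nhdsWithin ?_
  filter_upwards [self_mem_nhdsWithin, mem_nhdsWithin_of_mem_nhds (Iio_mem_nhds (lt_add_one t))]
    with r hr hr'
  exact ⟨hr, le_of_lt hr'⟩

theorem weighted_absolutelyContinuous (hy : IsScalarSolution a y) (A : ℝ) (j : ι) {s t : ℝ}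
    (hs : 0 ≤ s) (hst : s ≤ t) :
    AbsolutelyContinuousOnInterval (fun r => Real.exp (A * r) * y j r) s t := by
  have h1 : AbsolutelyContinuousOnInterval (fun r => Real.exp (A * r)) s t :=
    ContDiffOn.absolutelyContinuousOnInterval (by fun_prop)
  refine h1.fun_mul ((hy.absolutelyContinuous j (t + 1) (by linarith)).mono ?_)
  rw [Set.uIcc_of_le hst, Set.uIcc_of_le (by linarith)]
  exact Set.Icc_subset_Icc hs (by linarith)

/-- For `A` at least the total weight of each agent, all coefficients of the equations for the
weighted state `exp (A t) * y j t` are nonnegative. -/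
theorem ae_deriv_weighted (hy : IsScalarSolution a y) (A : ℝ) : ∀ᵐ t, 0 < t → ∀ j,
    deriv (fun r => Real.exp (A * r) * y j r) t =
      (A - ∑ k, a j k t) * (Real.exp (A * t) * y j t)
        + ∑ k, a j k t * (Real.exp (A * t) * y k t) := by
  filter_upwards [(ae_restrict_iff' measurableSet_Ioi).1 hy.ae_hasDerivAt] with t ht h0 j
  have h1 : HasDerivAt (fun r => Real.exp (A * r)) (Real.exp (A * t) * (A * 1)) t :=
    ((hasDerivAt_id t).const_mul A).exp
  have h2 : ∑ k, a j k t * (Real.exp (A * t) * y k t)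
      = Real.exp (A * t) * ∑ k, a j k t * y k t := by
    rw [Finset.mul_sum]
    exact Finset.sum_congr rfl fun k _ => by ring
  rw [(h1.fun_mul (ht h0 j)).deriv, h2]
  simp only [mul_sub, Finset.sum_sub_distrib, ← Finset.sum_mul]
  ring

/-- Comparison in integrated form: a lower bound for the derivative of a weighted state bounds its
increment from below. -/
theorem integral_le_weighted_sub (hy : IsScalarSolution a y) (A : ℝ) (j : ι) {s t : ℝ}
    (hs : 0 ≤ s) (hst : s ≤ t) {g : ℝ → ℝ} (hg : IntervalIntegrable g volume s t)
    (h : ∀ r, s ≤ r → g r ≤ (A - ∑ k, a j k r) * (Real.exp (A * r) * y j r)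
        + ∑ k, a j k r * (Real.exp (A * r) * y k r)) :
    ∫ r in s..t, g r ≤ Real.exp (A * t) * y j t - Real.exp (A * s) * y j s := by
  rw [← (hy.weighted_absolutelyContinuous A j hs hst).integral_deriv_eq_sub]
  refine intervalIntegral.integral_mono_ae_restrict hst hg
    (hy.weighted_absolutelyContinuous A j hs hst).intervalIntegrable_deriv ?_
  rw [← restrict_Ioc_eq_restrict_Icc]
  filter_upwards [ae_restrict_of_ae (hy.ae_deriv_weighted A), ae_restrict_mem measurableSet_Ioc]
    with r hr hr'
  rw [hr (hs.trans_lt hr'.1) j]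
  exact h r hr'.1.le

/-! ### Nonnegative solutions -/

theorem sum_weight_le {C : ℝ} (haC : ∀ j k, ∀ t : ℝ, 0 ≤ t → a j k t ≤ C) (j : ι) {t : ℝ}
    (ht : 0 ≤ t) : ∑ k, a j k t ≤ Fintype.card ι * C :=
  (Finset.sum_le_sum fun k _ => haC j k t ht).trans_eq (by simp)

/-- The nonnegative orthant is forward invariant. -/
theorem nonneg_of_nonneg (hy : IsScalarSolution a y) {C : ℝ}
    (ha0 : ∀ j k, ∀ t : ℝ, 0 ≤ t → 0 ≤ a j k t) (haC : ∀ j k, ∀ t : ℝ, 0 ≤ t → a j k t ≤ C)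
    {t₀ : ℝ} (ht₀ : 0 ≤ t₀) (h₀ : ∀ j, 0 ≤ y j t₀) {t : ℝ} (ht : t₀ ≤ t) (j : ι) :
    0 ≤ y j t := by
  have hC : 0 ≤ C := (ha0 j j 0 le_rfl).trans (haC j j 0 le_rfl)
  set A : ℝ := Fintype.card ι * C with hA
  have hA0 : 0 ≤ A := by positivity
  -- `w` is the total negative part of the weighted state, frozen before `t₀` in order
  -- to be continuous on all of `ℝ`
  set w : ℝ → ℝ := fun r => ∑ k, max 0 (-(Real.exp (A * max t₀ r) * y k (max t₀ r))) with hw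
  have hmax : Continuous fun r : ℝ => max t₀ r := continuous_const.max continuous_id
  have hwc : Continuous w := by
    refine continuous_finsetSum _ fun k _ => continuous_const.max (Continuous.neg ?_)
    exact (Real.continuous_exp.comp (continuous_const.mul hmax)).mul
      ((hy.continuousOn k).comp_continuous hmax fun r => ht₀.trans (le_max_left _ _))
  have hw0 : ∀ r, 0 ≤ w r := fun r => Finset.sum_nonneg fun k _ => le_max_left _ _
  have hneg : ∀ k r, t₀ ≤ r → -(Real.exp (A * r) * y k r) ≤ w r := by
    intro k r hr
    have h := Finset.single_le_sum
      (f := fun k => max 0 (-(Real.exp (A * max t₀ r) * y k (max t₀ r))))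
      (fun k _ => le_max_left _ _) (Finset.mem_univ k)
    refine le_trans ?_ h
    simp only [max_eq_right hr]
    exact le_max_right _ _
  -- each of `A - ∑ k, a j k` and `∑ k, a j k` lies in `[0, A]`, so no weighted state falls faster
  -- than at rate `2 A w`
  have hlow : ∀ k r, t₀ ≤ r →
      -(Real.exp (A * r) * y k r) ≤ 2 * A * ∫ q in t₀..r, w q := by
    intro k r hr
    have h := hy.integral_le_weighted_sub A k ht₀ hr (g := fun q => -(2 * A) * w q)
      ((hwc.const_mul _).intervalIntegrable _ _) fun q hq => ?_
    · rw [intervalIntegral.integral_const_mul] at h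
      have := mul_nonneg (Real.exp_pos (A * t₀)).le (h₀ k)
      linarith
    · have hq0 := ht₀.trans hq
      have h1 : -(A * w q) ≤ (A - ∑ l, a k l q) * (Real.exp (A * q) * y k q) := by
        have hs0 : 0 ≤ ∑ l, a k l q := Finset.sum_nonneg fun l _ => ha0 k l q hq0
        have hs := sum_weight_le haC k hq0
        have := mul_le_mul_of_nonneg_left (hneg k q hq) (sub_nonneg.2 hs)
        nlinarith [mul_nonneg hs0 (hw0 q)]
      have h2 : -(A * w q) ≤ ∑ l, a k l q * (Real.exp (A * q) * y l q) := by
        have h3 : ∑ _l : ι, -(C * w q) ≤ ∑ l, a k l q * (Real.exp (A * q) * y l q) := by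
          refine Finset.sum_le_sum fun l _ => ?_
          have h4 := mul_le_mul_of_nonneg_left (hneg l q hq) (ha0 k l q hq0)
          have h5 := mul_le_mul_of_nonneg_right (haC k l q hq0) (hw0 q)
          linarith
        refine le_trans (le_of_eq ?_) h3
        simp [hA, mul_assoc]
      linarith
  have hI0 : ∀ r, t₀ ≤ r → 0 ≤ ∫ q in t₀..r, w q := fun r hr =>
    intervalIntegral.integral_nonneg hr fun q _ => hw0 q
  have hU : ∀ r, HasDerivAt (fun t => ∫ q in t₀..t, w q) (w r) r := fun r =>
    (hwc.integral_hasStrictDerivAt t₀ r).hasDerivAt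
  have hzero := eq_zero_of_abs_deriv_le_mul_abs_self_of_eq_zero_right (a := t₀) (b := t)
    (K := Fintype.card ι * (2 * A)) (fun r _ => (hU r).continuousAt.continuousWithinAt)
    (fun r _ => (hU r).hasDerivWithinAt) (by simp) (fun r hr => by
      rw [Real.norm_of_nonneg (hw0 r), Real.norm_of_nonneg (hI0 r hr.1)]
      refine (Finset.sum_le_sum (g := fun _ => 2 * A * ∫ q in t₀..r, w q) fun k _ =>
        max_le (mul_nonneg (by positivity) (hI0 r hr.1)) ?_).trans_eq (by simp [mul_assoc])
      rw [max_eq_right hr.1]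
      exact hlow k r hr.1) t ⟨ht, le_rfl⟩
  have h := hlow j t ht
  rw [hzero, mul_zero, neg_nonpos] at h
  exact nonneg_of_mul_nonneg_right h (Real.exp_pos _)

/-- Along a nonnegative solution no state decays faster than `exp (-A t)`, with `A = card ι * C`. -/
theorem weighted_le_weighted (hy : IsScalarSolution a y) {C : ℝ}
    (ha0 : ∀ j k, ∀ t : ℝ, 0 ≤ t → 0 ≤ a j k t) (haC : ∀ j k, ∀ t : ℝ, 0 ≤ t → a j k t ≤ C)
    {t₀ : ℝ} (ht₀ : 0 ≤ t₀) (h₀ : ∀ j, 0 ≤ y j t₀) {s t : ℝ} (hs : t₀ ≤ s) (hst : s ≤ t) (j : ι) :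
    Real.exp (Fintype.card ι * C * s) * y j s ≤ Real.exp (Fintype.card ι * C * t) * y j t := by
  have h := hy.integral_le_weighted_sub (Fintype.card ι * C) j (ht₀.trans hs) hst (g := fun _ => 0)
    (by simp) fun r hr => ?_
  · simp only [intervalIntegral.integral_zero] at h
    linarith
  · have hr0 := ht₀.trans (hs.trans hr)
    have hy0 := fun k => hy.nonneg_of_nonneg ha0 haC ht₀ h₀ (hs.trans hr) k
    exact add_nonneg (mul_nonneg (sub_nonneg.2 (sum_weight_le haC j hr0))
      (mul_nonneg (Real.exp_pos _).le (hy0 j)))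
      (Finset.sum_nonneg fun k _ => mul_nonneg (ha0 j k r hr0)
        (mul_nonneg (Real.exp_pos _).le (hy0 k)))

/-- Agent `j` picks up from agent `k` at least the fraction `∫ a j k` of its weighted state. -/
theorem mul_integral_le_weighted (hy : IsScalarSolution a y) {C : ℝ}
    (ha0 : ∀ j k, ∀ t : ℝ, 0 ≤ t → 0 ≤ a j k t) (haC : ∀ j k, ∀ t : ℝ, 0 ≤ t → a j k t ≤ C)
    {t₀ : ℝ} (ht₀ : 0 ≤ t₀) (h₀ : ∀ j, 0 ≤ y j t₀) {s t : ℝ} (hs : t₀ ≤ s) (hst : s ≤ t) (j k : ι)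
    (hint : IntervalIntegrable (a j k) volume s t) :
    (∫ r in s..t, a j k r) * (Real.exp (Fintype.card ι * C * s) * y k s)
      ≤ Real.exp (Fintype.card ι * C * t) * y j t := by
  have hys := fun i => hy.nonneg_of_nonneg ha0 haC ht₀ h₀ hs i
  have h := hy.integral_le_weighted_sub (Fintype.card ι * C) j (ht₀.trans hs) hst
    (g := fun r => a j k r * (Real.exp (Fintype.card ι * C * s) * y k s))
    (hint.mul_const _) fun r hr => ?_
  · rw [intervalIntegral.integral_mul_const] at h
    linarith [mul_nonneg (Real.exp_pos (Fintype.card ι * C * s)).le (hys j)]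
  · have hr0 := ht₀.trans (hs.trans hr)
    have hy0 := fun i => mul_nonneg (Real.exp_pos (Fintype.card ι * C * r)).le
      (hy.nonneg_of_nonneg ha0 haC ht₀ h₀ (hs.trans hr) i)
    have h1 := mul_nonneg (sub_nonneg.2 (sum_weight_le haC j hr0)) (hy0 j)
    have h2 := Finset.single_le_sum
      (f := fun i => a j i r * (Real.exp (Fintype.card ι * C * r) * y i r))
      (fun i _ => mul_nonneg (ha0 j i r hr0) (hy0 i)) (Finset.mem_univ k)
    have h3 := mul_le_mul_of_nonneg_left
      (hy.weighted_le_weighted ha0 haC ht₀ h₀ hs hr k) (ha0 j k r hr0)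
    linarith

end IsScalarSolution

/-! ### Influence of a globally reachable node -/

/-- Along a path from `i` to `l` the delays of the arrows add up and their lower bounds multiply. -/
theorem exists_le_of_reachable {ι : Type*} [Fintype ι] {a : ι → ι → ℝ → ℝ} {C : ℝ}
    (ha0 : ∀ j k, ∀ t : ℝ, 0 ≤ t → 0 ≤ a j k t) (haC : ∀ j k, ∀ t : ℝ, 0 ≤ t → a j k t ≤ C)
    (hai : ∀ j k, ∀ s t : ℝ, 0 ≤ s → s ≤ t → IntervalIntegrable (a j k) volume s t)
    {i l : ι} (hil : Relation.ReflTransGen (fun j k => ConditionB (a j k)) i l) :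
    ∃ S c : ℝ, 0 ≤ S ∧ 0 < c ∧ ∀ y, IsScalarSolution a y → ∀ t₀, 0 ≤ t₀ → (∀ j, 0 ≤ y j t₀) →
      c * (Real.exp (Fintype.card ι * C * t₀) * y l t₀)
        ≤ Real.exp (Fintype.card ι * C * (t₀ + S)) * y i (t₀ + S) := by
  induction hil using Relation.ReflTransGen.head_induction_on with
  | refl => exact ⟨0, 1, le_rfl, one_pos, fun y _ t₀ _ _ => by simp⟩
  | @head j k hjk _ ih =>
    obtain ⟨S, c, hS, hc, ih⟩ := ih
    obtain ⟨T, μ, hT, hμ, hjk⟩ := hjk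
    refine ⟨S + T, μ * c, by positivity, by positivity, fun y hy t₀ ht₀ h₀ => ?_⟩
    have h1 := hy.mul_integral_le_weighted ha0 haC ht₀ h₀ (s := t₀ + S) (t := t₀ + S + T)
      (by linarith) (by linarith) j k (hai _ _ _ _ (by linarith) (by linarith))
    have h2 := hy.nonneg_of_nonneg ha0 haC ht₀ h₀ (t := t₀ + S) (by linarith) k
    rw [← add_assoc, mul_assoc]
    exact (mul_le_mul_of_nonneg_left (ih y hy t₀ ht₀ h₀) hμ.le).trans
      ((mul_le_mul_of_nonneg_right (hjk (t₀ + S) (by linarith))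
        (mul_nonneg (Real.exp_pos _).le h2)).trans h1)

/-- The state of a globally reachable node reaches all agents within one common time and with one
common factor; the weights `exp (A t)` are absorbed into `c`. -/
theorem exists_uniform_le_of_globally_reachable {ι : Type*} [Fintype ι]
    {a : ι → ι → ℝ → ℝ} {C : ℝ}
    (ha0 : ∀ j k, ∀ t : ℝ, 0 ≤ t → 0 ≤ a j k t) (haC : ∀ j k, ∀ t : ℝ, 0 ≤ t → a j k t ≤ C)
    (hai : ∀ j k, ∀ s t : ℝ, 0 ≤ s → s ≤ t → IntervalIntegrable (a j k) volume s t)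
    {l : ι} (hl : ∀ i, Relation.ReflTransGen (fun j k => ConditionB (a j k)) i l) :
    ∃ S c : ℝ, 0 < S ∧ 0 < c ∧ c ≤ 1 ∧ ∀ y, IsScalarSolution a y → ∀ t₀, 0 ≤ t₀ →
      (∀ j, 0 ≤ y j t₀) → ∀ i, c * y l t₀ ≤ y i (t₀ + S) := by
  choose S c hS hc h using fun i => exists_le_of_reachable ha0 haC hai (hl i)
  have : Nonempty ι := ⟨l⟩
  obtain ⟨i₁, hi₁⟩ := Finite.exists_max S
  obtain ⟨i₂, hi₂⟩ := Finite.exists_min c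
  set A : ℝ := Fintype.card ι * C
  refine ⟨S i₁ + 1, min 1 (c i₂ * Real.exp (-(A * (S i₁ + 1)))), by linarith [hS i₁],
    lt_min one_pos (mul_pos (hc _) (Real.exp_pos _)), min_le_left _ _,
    fun y hy t₀ ht₀ h₀ i => ?_⟩
  have h1 := hy.weighted_le_weighted ha0 haC ht₀ h₀ (s := t₀ + S i) (t := t₀ + (S i₁ + 1))
    (by linarith [hS i]) (by linarith [hi₁ i]) i
  have h2 := (mul_le_mul_of_nonneg_right (hi₂ i)
    (mul_nonneg (Real.exp_pos (A * t₀)).le (h₀ l))).trans ((h i y hy t₀ ht₀ h₀).trans h1)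
  refine (mul_le_mul_of_nonneg_right (min_le_right _ _) (h₀ l)).trans ?_
  have h3 : Real.exp (A * (t₀ + (S i₁ + 1)))
      * (c i₂ * Real.exp (-(A * (S i₁ + 1))) * y l t₀) = c i₂ * (Real.exp (A * t₀) * y l t₀) := by
    have : Real.exp (A * t₀)
        = Real.exp (A * (t₀ + (S i₁ + 1))) * Real.exp (-(A * (S i₁ + 1))) := by
      rw [← Real.exp_add]
      congr 1
      ring
    rw [this]
    ring
  exact le_of_mul_le_mul_left (h3.trans_le h2) (Real.exp_pos _)

/-! ### Contraction and consensus -/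

namespace IsScalarSolution

variable {ι : Type*} [Fintype ι] {a : ι → ι → ℝ → ℝ} {y : ι → ℝ → ℝ}

theorem mem_Icc_of_mem_Icc (hy : IsScalarSolution a y) {C : ℝ}
    (ha0 : ∀ j k, ∀ t : ℝ, 0 ≤ t → 0 ≤ a j k t) (haC : ∀ j k, ∀ t : ℝ, 0 ≤ t → a j k t ≤ C)
    {t₀ : ℝ} (ht₀ : 0 ≤ t₀) {m M : ℝ} (h₀ : ∀ j, y j t₀ ∈ Set.Icc m M) {t : ℝ} (ht : t₀ ≤ t)
    (j : ι) : y j t ∈ Set.Icc m M := by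
  have h1 := (hy.affine 1 (-m)).nonneg_of_nonneg ha0 haC ht₀
    (fun j => by linarith [(h₀ j).1]) ht j
  have h2 := (hy.affine (-1) M).nonneg_of_nonneg ha0 haC ht₀
    (fun j => by linarith [(h₀ j).2]) ht j
  exact ⟨by linarith, by linarith⟩

theorem exists_tendsto_of_globally_reachable (hy : IsScalarSolution a y) {C : ℝ}
    (ha0 : ∀ j k, ∀ t : ℝ, 0 ≤ t → 0 ≤ a j k t) (haC : ∀ j k, ∀ t : ℝ, 0 ≤ t → a j k t ≤ C)
    (hai : ∀ j k, ∀ s t : ℝ, 0 ≤ s → s ≤ t → IntervalIntegrable (a j k) volume s t)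
    {l : ι} (hl : ∀ i, Relation.ReflTransGen (fun j k => ConditionB (a j k)) i l) :
    ∃ p : ℝ, ∀ j, Tendsto (y j) atTop (𝓝 p) := by
  obtain ⟨S, c, hS, hc, hc1, hcon⟩ := exists_uniform_le_of_globally_reachable ha0 haC hai hl
  have : Nonempty ι := ⟨l⟩
  obtain ⟨i₁, hi₁⟩ := Finite.exists_max fun i => y i 0
  obtain ⟨i₂, hi₂⟩ := Finite.exists_min fun i => y i 0
  have hwidth : ∀ n : ℕ, ∃ m M : ℝ, M - m = (1 - c / 2) ^ n * (y i₁ 0 - y i₂ 0) ∧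
      ∀ j, y j (n * S) ∈ Set.Icc m M := by
    intro n
    induction n with
    | zero => exact ⟨y i₂ 0, y i₁ 0, by simp, fun j => by simpa using ⟨hi₂ j, hi₁ j⟩⟩
    | succ n ih =>
      obtain ⟨m, M, hmM, h⟩ := ih
      have hn : 0 ≤ n * S := by positivity
      have hnS : ((n + 1 : ℕ) : ℝ) * S = n * S + S := by push_cast; ring
      have hnext := fun j => hy.mem_Icc_of_mem_Icc ha0 haC hn h (t := n * S + S) (by linarith) j
      rw [hnS, pow_succ]
      -- the root lies in one half of `[m, M]` and pulls all agents off the opposite end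
      rcases le_total ((m + M) / 2) (y l (n * S)) with hmid | hmid
      · refine ⟨m + c / 2 * (M - m), M, by rw [mul_right_comm, ← hmM]; ring,
          fun j => ⟨?_, (hnext j).2⟩⟩
        have h1 := hcon _ (hy.affine 1 (-m)) (n * S) hn (fun j => by linarith [(h j).1]) j
        nlinarith
      · refine ⟨m, M - c / 2 * (M - m), by rw [mul_right_comm, ← hmM]; ring,
          fun j => ⟨(hnext j).1, ?_⟩⟩
        have h1 := hcon _ (hy.affine (-1) M) (n * S) hn (fun j => by linarith [(h j).2]) j
        nlinarith
  have hosc : ∀ ε > 0, ∃ t₀ : ℝ, ∀ i j s t, t₀ ≤ s → t₀ ≤ t → dist (y i s) (y j t) < ε := by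
    intro ε hε
    have hlim : Tendsto (fun n : ℕ => (1 - c / 2) ^ n * (y i₁ 0 - y i₂ 0)) atTop (𝓝 0) := by
      simpa using (tendsto_pow_atTop_nhds_zero_of_lt_one (r := 1 - c / 2) (by linarith)
        (by linarith)).mul_const (y i₁ 0 - y i₂ 0)
    obtain ⟨n, hn⟩ := (hlim.eventually_lt_const hε).exists
    obtain ⟨m, M, hmM, h⟩ := hwidth n
    refine ⟨n * S, fun i j s t hs ht => ?_⟩
    have hn0 : 0 ≤ n * S := by positivity
    have h1 := hy.mem_Icc_of_mem_Icc ha0 haC hn0 h hs i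
    have h2 := hy.mem_Icc_of_mem_Icc ha0 haC hn0 h ht j
    exact (Real.dist_le_of_mem_Icc h1 h2).trans_lt (hmM.trans_lt hn)
  obtain ⟨p, hp⟩ : ∃ p, Tendsto (y l) atTop (𝓝 p) := by
    refine cauchy_map_iff_exists_tendsto.1 (Metric.cauchy_iff.2 ⟨inferInstance, fun ε hε => ?_⟩)
    obtain ⟨t₀, h⟩ := hosc ε hε
    refine ⟨y l '' Set.Ici t₀, image_mem_map (Ici_mem_atTop t₀), ?_⟩
    rintro _ ⟨s, hs, rfl⟩ _ ⟨t, ht, rfl⟩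
    exact h l l s t hs ht
  refine ⟨p, fun j => hp.congr_dist ?_⟩
  refine Metric.tendsto_atTop.2 fun ε hε => ?_
  obtain ⟨t₀, h⟩ := hosc ε hε
  exact ⟨t₀, fun t ht => by simpa using h l j t t ht ht⟩

end IsScalarSolution

theorem corollary1 {N d : ℕ} (a : Fin N → Fin N → ℝ → ℝ)
    (ha_nonneg : ∀ j k, ∀ t : ℝ, 0 ≤ t → 0 ≤ a j k t)
    (ha_meas : ∀ j k, AEMeasurable (a j k) (volume.restrict (Set.Ici (0 : ℝ))))
    (ha_bdd : ∀ j k, ∃ M : ℝ, ∀ t : ℝ, 0 ≤ t → a j k t ≤ M) :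
    (∀ j k, List.TFAE [ConditionA (a j k), ConditionB (a j k), ConditionC (a j k)]) ∧
    ((∃ l, IsGloballyReachable (connectionGraph a) l) →
      ∀ x₀ : Fin N → EuclideanSpace ℝ (Fin d),
      ∀ x : Fin N → ℝ → EuclideanSpace ℝ (Fin d),
        IsSolution a x → (∀ j, x j 0 = x₀ j) → ConvergesToConsensus x) := by
  have hai : ∀ j k, ∀ s t : ℝ, 0 ≤ s → s ≤ t → IntervalIntegrable (a j k) volume s t :=
    fun j k s t => intervalIntegrable_of_bounded_on_nonneg (ha_nonneg j k) (ha_meas j k)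
      (ha_bdd j k)
  have htfae := fun j k => conditions_tfae (ha_nonneg j k) (hai j k)
  refine ⟨htfae, ?_⟩
  rintro ⟨l, hl⟩ - x hx -
  have hadj : ∀ j k, (connectionGraph a).Adj j k → ConditionB (a j k) := fun j k hjk =>
    hjk.elim ((htfae j k).out 0 1).1 fun h => h.elim id ((htfae j k).out 2 1).1
  have hl' : ∀ i, Relation.ReflTransGen (fun j k => ConditionB (a j k)) i l := fun i =>
    Relation.ReflTransGen.mono hadj _ _ (hl i)
  choose M hM using ha_bdd
  obtain ⟨C, hC⟩ := Finite.exists_le fun q : Fin N × Fin N => M q.1 q.2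
  choose p hp using fun i => (hx.coordinate i).exists_tendsto_of_globally_reachable ha_nonneg
    (fun j k t ht => (hM j k t ht).trans (hC (j, k))) hai hl'
  refine ⟨WithLp.toLp 2 p, fun j => ?_⟩
  exact ((PiLp.continuous_toLp 2 _).tendsto p).comp (tendsto_pi_nhds.2 fun i => hp i j)
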